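/- **Theorem 5.** *Setting.* A library has $L$ files and a cache holds at most $C$ of them, $1\le C\le L$. In each slot $t=1,\dots,T$ one file $x_t$ is requested; the sequence $x=(x_1,\dots,x_T)$ is fixed in advance by an oblivious adversary. Let $s\ge 1$ and let $r_1,\dots,r_s\ge 1$ be integers with $\sum_{i=1}^s r_i=T$; put $r_0=1$ and $t_i=\sum_{j=0}^{i-1}r_j$, so that $t_i$ is the first slot of the $i$-th period. A (possibly randomized) online caching policy $\pi$ chooses, at the beginning of each slot $t$, a set $C(t)$ of at most $C$ cached files as a function of $x_1,\dots,x_{t-1}$ and of its internal randomness, and within the horizon $T$ it may change the cache only at the beginning of the slots $t_1,\dots,t_s$. There is no switch cost. With $X(k)$ the number of $t\le T$ with $x_t=k$, its regret against an oblivious adversary is $$R_A^\pi(T)=\sup_{x}\Big(\max_{S:\,|S|\le C}\ \sum_{k\in S}X(k)-\sum_{t=1}^T\mathbb P\big(x_t\in C(t)\big)\Big),$$ where the supremum is over all request sequences and the probability is over the randomness of the policy. (a) If $L\ge 2C$, then for every such $L,C,T,s,r_1,\dots,r_s$ and every such policy $\pi$, $$R_A^\pi(T)\ \ge\ \frac12\left(0.15\sqrt{C\sum_{i=1}^s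 r_i^2}\left(1-\frac{(C-1)\sum_{i=1}^s r_i^4}{2\big(\sum_{i=1}^s r_i^2\big)^2}\right)-0.6\,C\max_{1\le i\le s}r_i\right).$$ (b) Let $\alpha>0$ and let FTPL$(\alpha\sqrt t)$ be the policy that draws $\gamma\sim\mathcal N(0,I_{L})$ once and, at the beginning of each slot $t\in\{t_1,\dots,t_s\}$, caches the $C$ files $k$ with the largest perturbed counts $|\{t'<t: x_{t'}=k\}|+\alpha\sqrt t\,\gamma(k)$ (ties, which have probability zero, go to the smaller index), and keeps the cache unchanged at all other slots. Then there is a constant $K$ depending only on $L$ and $C$ such that for all $T,s,r_1,\dots,r_s$ as above and all $\alpha>0$, $$R_A^{\mathrm{FTPL}(\alpha\sqrt t)}(T)\ \le\ K\,\alpha\sqrt T+\sqrt{\frac2\pi}\ \sum_{i=1}^s\frac{r_i^2}{\alpha\sqrt{\sum_{j=0}^{i-1}r_j}},\qquad r_0=1.$$ -/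

import Mathlib

open MeasureTheory ProbabilityTheory

noncomputable section

namespace Caching

/-- `X(i)`: the number of requests for file `i` in a finite request history. -/
def requestCount {L n : ℕ} (h : Fin n → Fin L) (i : Fin L) : ℕ :=
  (Finset.univ.filter fun k => h k = i).card

/-- The part of the request sequence that is known at the beginning of slot `t`, before the request
of that slot arrives. Slots are numbered from `0`, so `t` requests have been seen. -/
def history {L T : ℕ} (x : Fin T → Fin L) (t : Fin T) : Fin (t : ℕ) → Fin L :=
  fun k => x (Fin.castLE t.isLt.le k)

/-- First slot (numbered from `0`) of the `i`-th inter-switching period. -/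
def periodStart {s : ℕ} (r : Fin s → ℕ) (i : Fin s) : ℕ :=
  ∑ j ∈ Finset.Iio i, r j

/-- The slots (numbered from `0`) at whose beginning the cache may change its contents. -/
def IsUpdateSlot {s : ℕ} (r : Fin s → ℕ) (t : ℕ) : Prop :=
  ∃ i : Fin s, t = periodStart r i

/-- A (possibly randomized) online caching policy for a library of `L` files, a cache of size `C`
and horizon `T`, which may change the cache only at the update slots given by the periods `r`.
A point of `Ω` is a realization of the internal randomness of the policy. -/
structure RestrictedPolicy (L C T : ℕ) {s : ℕ} (r : Fin s → ℕ) (Ω : Type*)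
    [MeasurableSpace Ω] where
  /-- The set of cached files in slot `t`, as a function of the past requests. -/
  cache : (t : Fin T) → (Fin (t : ℕ) → Fin L) → Ω → Finset (Fin L)
  card_le : ∀ t h ω, (cache t h ω).card ≤ C
  measurableSet_mem : ∀ t h i, MeasurableSet {ω | i ∈ cache t h ω}
  hold : ∀ (t : ℕ) (ht : t + 1 < T), ¬ IsUpdateSlot r (t + 1) → ∀ (x : Fin T → Fin L) (ω : Ω),
    cache ⟨t + 1, ht⟩ (history x ⟨t + 1, ht⟩) ω =
      cache ⟨t, (Nat.lt_succ_self t).trans ht⟩ (history x ⟨t, (Nat.lt_succ_self t).trans ht⟩) ω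

/-- Number of hits of the best static cache configuration of size at most `C` in hindsight. -/
def bestStaticHits {L T : ℕ} (C : ℕ) (x : Fin T → Fin L) : ℝ :=
  ⨆ S : {S : Finset (Fin L) // S.card ≤ C}, ∑ i ∈ S.1, (requestCount x i : ℝ)

namespace RestrictedPolicy

variable {L C T s : ℕ} {r : Fin s → ℕ} {Ω : Type*} [MeasurableSpace Ω]

/-- Regret on a fixed request sequence `x`, without switch cost; `μ` is the law of the internal
randomness of the policy. -/
def regretOn (P : RestrictedPolicy L C T r Ω) (μ : Measure Ω) (x : Fin T → Fin L) : ℝ :=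
  bestStaticHits C x -
    ∑ t : Fin T, ∫ ω, (if x t ∈ P.cache t (history x t) ω then (1 : ℝ) else 0) ∂μ

/-- Regret against an oblivious adversary: the worst case over all request sequences. -/
def regret (P : RestrictedPolicy L C T r Ω) (μ : Measure Ω) : ℝ :=
  ⨆ x : Fin T → Fin L, P.regretOn μ x

end RestrictedPolicy

/-- File `j` is ranked before file `i` by the scores `v`; ties go to the smaller index. -/
def RankedBefore {L : ℕ} (v : Fin L → ℝ) (j i : Fin L) : Prop :=
  v i < v j ∨ (v j = v i ∧ j < i)

open Classical in
/-- The `C` files with the highest scores `v` (all files if `L ≤ C`). -/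
def topFiles {L : ℕ} (C : ℕ) (v : Fin L → ℝ) : Finset (Fin L) :=
  Finset.univ.filter fun i => (Finset.univ.filter fun j => RankedBefore v j i).card < C

lemma topFiles_card_le {L : ℕ} (C : ℕ) (v : Fin L → ℝ) : (topFiles C v).card ≤ C := by
  classical
  set rank : Fin L → ℕ := fun i => (Finset.univ.filter fun j => RankedBefore v j i).card with hr
  have hlt : ∀ a b, RankedBefore v a b → rank a < rank b := by
    intro a b hab
    apply Finset.card_lt_card
    rw [Finset.ssubset_iff_of_subset]
    · refine ⟨a, by simpa using hab, ?_⟩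
      intro ha
      have := (Finset.mem_filter.1 ha).2
      unfold RankedBefore at this
      grind
    · intro j hj
      have hja := (Finset.mem_filter.1 hj).2
      refine Finset.mem_filter.2 ⟨Finset.mem_univ _, ?_⟩
      unfold RankedBefore at *
      grind
  have hinj : Function.Injective rank := by
    intro a b hab
    by_contra hne
    have : RankedBefore v a b ∨ RankedBefore v b a := by
      unfold RankedBefore
      grind
    rcases this with h | h
    · exact absurd hab (hlt _ _ h).ne
    · exact absurd hab (hlt _ _ h).ne'
  have : (topFiles C v).card ≤ (Finset.range C).card := by
    refine Finset.card_le_card_of_injOn rank ?_ hinj.injOn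
    intro i hi
    have hi' : i ∈ topFiles C v := hi
    simp only [topFiles, Finset.mem_filter, Finset.mem_univ, true_and] at hi'
    simpa [hr] using hi'
  simpa using this

lemma measurableSet_mem_topFiles {L : ℕ} (C : ℕ) (i : Fin L) :
    MeasurableSet {v : Fin L → ℝ | i ∈ topFiles C v} := by
  classical
  have hm : Measurable fun v : Fin L → ℝ =>
      (Finset.univ.filter fun j => RankedBefore v j i).card := by
    simp only [Finset.card_filter]
    refine Finset.measurable_sum _ fun j _ => Measurable.ite ?_ measurable_const measurable_const
    have h1 : MeasurableSet {v : Fin L → ℝ | v i < v j} :=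
      measurableSet_lt (measurable_pi_apply i) (measurable_pi_apply j)
    have h2 : MeasurableSet {v : Fin L → ℝ | v j = v i} :=
      measurableSet_eq_fun (measurable_pi_apply j) (measurable_pi_apply i)
    exact h1.union (h2.inter (MeasurableSet.const _))
  have : {v : Fin L → ℝ | i ∈ topFiles C v} =
      (fun v : Fin L → ℝ => (Finset.univ.filter fun j => RankedBefore v j i).card) ⁻¹'
        Set.Iio C := by
    ext v
    simp only [topFiles, Finset.mem_filter, Finset.mem_univ, true_and, Set.mem_ofPred_eq,
      Set.mem_preimage, Set.mem_Iio]
  rw [this]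
  exact hm measurableSet_Iio

/-- Perturbed request counts with learning rate `η` and perturbation `γ`. -/
def perturbedCount {L n : ℕ} (η : ℝ) (h : Fin n → Fin L) (γ : Fin L → ℝ) : Fin L → ℝ :=
  fun i => (requestCount h i : ℝ) + η * γ i

open Classical in
/-- The cache of FTPL: at an update slot it takes the `C` files with the highest perturbed counts,
at any other slot it keeps its contents. The learning rates `η 1, η 2, …` are indexed by slots
numbered from `1`, so that slot number `t` (from `0`) uses `η (t + 1)`. -/
def ftplCache {L s : ℕ} (C : ℕ) (r : Fin s → ℕ) (η : ℕ → ℝ) :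
    (t : ℕ) → (Fin t → Fin L) → (Fin L → ℝ) → Finset (Fin L)
  | 0, h, γ => topFiles C (perturbedCount (η 1) h γ)
  | t + 1, h, γ =>
      if IsUpdateSlot r (t + 1) then topFiles C (perturbedCount (η (t + 2)) h γ)
      else ftplCache C r η t (fun k => h k.castSucc) γ

lemma measurableSet_mem_topFiles_perturbedCount {L n : ℕ} (C : ℕ) (η : ℝ) (h : Fin n → Fin L)
    (i : Fin L) : MeasurableSet {γ | i ∈ topFiles C (perturbedCount η h γ)} := by
  have hm : Measurable fun γ : Fin L → ℝ => perturbedCount η h γ := by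
    refine measurable_pi_lambda _ fun j => ?_
    have hj : Measurable fun γ : Fin L → ℝ => γ j := measurable_pi_apply j
    exact (hj.const_mul η).const_add _
  exact hm (measurableSet_mem_topFiles C i)

/-- FTPL with learning rates `η`, restricted to the update slots given by `r`. Its internal
randomness is the perturbation vector `γ`, drawn once. -/
def ftpl (L C T : ℕ) {s : ℕ} (r : Fin s → ℕ) (η : ℕ → ℝ) :
    RestrictedPolicy L C T r (Fin L → ℝ) where
  cache t h γ := ftplCache C r η t h γ
  card_le := by
    rintro ⟨t, ht⟩ h γ
    dsimp only at h ⊢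
    clear ht
    induction t with
    | zero => exact topFiles_card_le _ _
    | succ t ih =>
      rw [ftplCache]
      split_ifs
      · exact topFiles_card_le _ _
      · exact ih _
  measurableSet_mem := by
    rintro ⟨t, ht⟩ h i
    dsimp only at h ⊢
    clear ht
    induction t with
    | zero => exact measurableSet_mem_topFiles_perturbedCount _ _ _ _
    | succ t ih =>
      simp only [ftplCache]
      split_ifs
      · exact measurableSet_mem_topFiles_perturbedCount _ _ _ _
      · exact ih _
  hold := by
    intro t ht hu x γ
    simp only [ftplCache, if_neg hu]
    rfl

/-- The standard normal law `N(0, I)` on `ℝ^L`. -/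
def stdNormal (L : ℕ) : Measure (Fin L → ℝ) :=
  Measure.pi fun _ => gaussianReal 0 1

end Caching

end

/-! Lower bound. Fix `2 * C` files grouped into `C` pairs and let every period repeat one of them,
drawn uniformly and independently. The cache of a period is determined by the earlier periods, so it
contains the current file with probability at most `1/2`, and the expected number of hits is at most
`T/2` (`two_mul_sum_hits_le`). The static cache that keeps the more popular file of each pair gets
`T/2` plus half the sum over the pairs of `|D|`, where `D` is the difference of the two counts
(`le_bestStaticHits_blockRequests`). Each `D` is a sum of independent symmetric variables weighted
by the `r i`; its second and fourth moments bound `E|D|` from below through a pointwise polynomial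
inequality (`sq_sub_fourth_le_abs`). No normal approximation is needed, and the bound holds even
without the subtracted maximum.

Upper bound. Within a period FTPL keeps both its counts and its learning rate frozen. A fictitious
cache with the same perturbation that also knows the requests up to and including the current one
loses at most a multiple of the final learning rate, by telescoping (`topScore_prefixCount_le`). The
real cache differs from it only by counts of the current period, at most `r i` for the requested
file. Since the Gaussian density is bounded, this costs at most `r i / (η √(2π))` in hit probability
per slot (`measureReal_mem_topFiles_sub_le`); summation over the `r i` slots of a period gives the
squares. -/

noncomputable section

namespace Caching

/-! ### The files with the highest scores -/

open Classical in
/-- The number of files that are ranked before file `i` by the scores `v`. -/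
def fileRank {L : ℕ} (v : Fin L → ℝ) (i : Fin L) : ℕ :=
  (Finset.univ.filter fun j => RankedBefore v j i).card

lemma mem_topFiles {L C : ℕ} {v : Fin L → ℝ} {i : Fin L} :
    i ∈ topFiles C v ↔ fileRank v i < C := by
  simp [topFiles, fileRank]

lemma fileRank_lt_of_rankedBefore {L : ℕ} {v : Fin L → ℝ} {a b : Fin L}
    (hab : RankedBefore v a b) : fileRank v a < fileRank v b := by
  classical
  apply Finset.card_lt_card
  rw [Finset.ssubset_iff_of_subset]
  · refine ⟨a, by simpa using hab, ?_⟩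
    intro ha
    have := (Finset.mem_filter.1 ha).2
    unfold RankedBefore at this
    grind
  · intro j hj
    have hja := (Finset.mem_filter.1 hj).2
    refine Finset.mem_filter.2 ⟨Finset.mem_univ _, ?_⟩
    unfold RankedBefore at *
    grind

lemma rankedBefore_or {L : ℕ} (v : Fin L → ℝ) {a b : Fin L} (hab : a ≠ b) :
    RankedBefore v a b ∨ RankedBefore v b a := by
  unfold RankedBefore
  grind

lemma fileRank_injective {L : ℕ} (v : Fin L → ℝ) : Function.Injective (fileRank v) := by
  intro a b hab
  by_contra hne
  rcases rankedBefore_or v hne with h | h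
  · exact absurd hab (fileRank_lt_of_rankedBefore h).ne
  · exact absurd hab (fileRank_lt_of_rankedBefore h).ne'

lemma fileRank_lt {L : ℕ} (v : Fin L → ℝ) (i : Fin L) : fileRank v i < L := by
  classical
  have : fileRank v i < (Finset.univ : Finset (Fin L)).card := by
    apply Finset.card_lt_card
    rw [Finset.ssubset_univ_iff]
    intro h
    have := h.symm ▸ Finset.mem_univ i
    have := (Finset.mem_filter.1 this).2
    unfold RankedBefore at this
    grind
  simpa using this

lemma card_topFiles {L C : ℕ} (hCL : C ≤ L) (v : Fin L → ℝ) : (topFiles C v).card = C := by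
  classical
  have himg : Finset.univ.image (fileRank v) = Finset.range L := by
    refine Finset.eq_of_subset_of_card_le (fun n hn => ?_) ?_
    · obtain ⟨i, -, rfl⟩ := Finset.mem_image.1 hn
      exact Finset.mem_range.2 (fileRank_lt v i)
    · rw [Finset.card_image_of_injective _ (fileRank_injective v)]
      simp
  have htop : (topFiles C v).image (fileRank v) = Finset.range C := by
    ext n
    simp only [Finset.mem_image, Finset.mem_range, mem_topFiles]
    constructor
    · rintro ⟨i, hi, rfl⟩
      exact hi
    · intro hn
      have : n ∈ Finset.univ.image (fileRank v) := by
        rw [himg]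
        exact Finset.mem_range.2 (hn.trans_le hCL)
      obtain ⟨i, -, rfl⟩ := Finset.mem_image.1 this
      exact ⟨i, hn, rfl⟩
  rw [← Finset.card_image_of_injective _ (fileRank_injective v), htop, Finset.card_range]

/-- The score of a file in `topFiles` is at least that of a file outside. -/
lemma le_of_mem_topFiles {L C : ℕ} {v : Fin L → ℝ} {i j : Fin L} (hi : i ∈ topFiles C v)
    (hj : j ∉ topFiles C v) : v j ≤ v i := by
  rw [mem_topFiles] at hi hj
  have hne : i ≠ j := by
    rintro rfl
    exact hj hi
  rcases rankedBefore_or v hne with h | h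
  · rcases h with h | h
    · exact h.le
    · exact h.1.ge
  · have := fileRank_lt_of_rankedBefore h
    omega

/-- Total score of the `C` files with the highest scores. -/
def topScore {L : ℕ} (C : ℕ) (v : Fin L → ℝ) : ℝ := ∑ i ∈ topFiles C v, v i

/-- Exchange argument: the two set differences have equal size, and every file of `topFiles` scores
at least as much as every file outside. -/
lemma sum_le_topScore {L C : ℕ} (hCL : C ≤ L) (v : Fin L → ℝ) {S : Finset (Fin L)}
    (hS : S.card = C) : ∑ i ∈ S, v i ≤ topScore C v := by
  classical
  have hcard : (S \ topFiles C v).card = (topFiles C v \ S).card :=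
    Finset.card_sdiff_comm (by rw [hS, card_topFiles hCL])
  have key : ∑ i ∈ S \ topFiles C v, v i ≤ ∑ i ∈ topFiles C v \ S, v i := by
    let e := Finset.equivOfCardEq hcard
    rw [← Finset.sum_coe_sort (S \ topFiles C v), ← Finset.sum_coe_sort (topFiles C v \ S),
      ← e.sum_comp]
    exact Finset.sum_le_sum fun i _ => le_of_mem_topFiles (Finset.mem_sdiff.1 (e i).2).1
      (Finset.mem_sdiff.1 i.2).2
  have h1 := Finset.sum_inter_add_sum_sdiff S (topFiles C v) v
  have h2 := Finset.sum_inter_add_sum_sdiff (topFiles C v) S v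
  rw [Finset.inter_comm] at h2
  unfold topScore
  linarith

lemma topScore_le_sum_abs {L : ℕ} (C : ℕ) (v : Fin L → ℝ) : topScore C v ≤ ∑ i, |v i| :=
  (Finset.sum_le_sum fun i _ => le_abs_self (v i)).trans
    (Finset.sum_le_univ_sum_of_nonneg fun i => abs_nonneg (v i))

/-- The optimal set for `v + w` is an admissible competitor for `v`. -/
lemma topScore_add_le {L C : ℕ} (hCL : C ≤ L) (v w : Fin L → ℝ) :
    topScore C (fun i => v i + w i) ≤ topScore C v + ∑ i ∈ topFiles C (fun i => v i + w i), w i := by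
  have := sum_le_topScore hCL v (card_topFiles hCL fun i => v i + w i)
  rw [topScore, Finset.sum_add_distrib]
  linarith

/-- Any file ranked before `k` under `w` is already ranked before it under `v`. Weak inequalities
suffice because ties are broken by index alone. -/
lemma mem_topFiles_mono {L C : ℕ} {v w : Fin L → ℝ} {k : Fin L} (hk : v k ≤ w k)
    (h : ∀ j, j ≠ k → w j ≤ v j) (hv : k ∈ topFiles C v) : k ∈ topFiles C w := by
  classical
  rw [mem_topFiles] at *
  refine lt_of_le_of_lt (Finset.card_le_card fun j hj => ?_) hv
  have hj' := (Finset.mem_filter.1 hj).2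
  refine Finset.mem_filter.2 ⟨Finset.mem_univ _, ?_⟩
  unfold RankedBefore at *
  by_cases hjk : j = k
  · subst hjk
    rcases hj' with h | h
    · exact absurd h (lt_irrefl _)
    · exact absurd h.2 (lt_irrefl _)
  · have := h j hjk
    grind

/-! ### Request counts of prefixes -/

/-- The number of requests for file `i` among the first `n` requests. -/
def prefixCount {L : ℕ} (x : ℕ → Fin L) (n : ℕ) (i : Fin L) : ℕ :=
  ((Finset.range n).filter fun t => x t = i).card

lemma prefixCount_zero {L : ℕ} (x : ℕ → Fin L) (i : Fin L) : prefixCount x 0 i = 0 := by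
  simp [prefixCount]

lemma prefixCount_succ {L : ℕ} (x : ℕ → Fin L) (n : ℕ) (i : Fin L) :
    prefixCount x (n + 1) i = prefixCount x n i + if x n = i then 1 else 0 := by
  rw [prefixCount, prefixCount, Finset.range_add_one, Finset.filter_insert]
  split_ifs <;> simp

lemma prefixCount_mono {L : ℕ} (x : ℕ → Fin L) {m n : ℕ} (h : m ≤ n) (i : Fin L) :
    prefixCount x m i ≤ prefixCount x n i :=
  Finset.card_le_card (Finset.filter_subset_filter _ (Finset.range_subset_range.2 h))

lemma prefixCount_add_le {L : ℕ} (x : ℕ → Fin L) (m d : ℕ) (i : Fin L) :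
    prefixCount x (m + d) i ≤ prefixCount x m i + d := by
  induction d with
  | zero => simp
  | succ d ih =>
    rw [← add_assoc, prefixCount_succ]
    split_ifs <;> omega

lemma requestCount_eq_prefixCount {L n : ℕ} (h : Fin n → Fin L) (x : ℕ → Fin L)
    (hx : ∀ k : Fin n, h k = x k) (i : Fin L) : requestCount h i = prefixCount x n i := by
  simp only [requestCount, prefixCount, Finset.card_filter, hx]
  exact Fin.sum_univ_eq_sum_range (fun t => if x t = i then 1 else 0) n

/-! ### Periods -/

lemma periodStart_add_le {s : ℕ} (r : Fin s → ℕ) {i j : Fin s} (h : i < j) :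
    periodStart r i + r i ≤ periodStart r j := by
  have hni : i ∉ Finset.Iio i := by simp
  rw [periodStart, add_comm, ← Finset.sum_insert hni]
  refine Finset.sum_le_sum_of_subset fun k hk => ?_
  rcases Finset.mem_insert.1 hk with rfl | hk
  · exact Finset.mem_Iio.2 h
  · exact Finset.mem_Iio.2 ((Finset.mem_Iio.1 hk).trans h)

lemma periodStart_mono {s : ℕ} (r : Fin s → ℕ) : Monotone (periodStart r) := fun _ _ h =>
  Finset.sum_le_sum_of_subset (Finset.Iio_subset_Iio h)

lemma periodStart_add_le_sum {s : ℕ} (r : Fin s → ℕ) (i : Fin s) :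
    periodStart r i + r i ≤ ∑ j, r j := by
  have hni : i ∉ Finset.Iio i := by simp
  rw [periodStart, add_comm, ← Finset.sum_insert hni]
  exact Finset.sum_le_sum_of_subset (Finset.subset_univ _)

lemma not_isUpdateSlot {s : ℕ} (r : Fin s → ℕ) (i : Fin s) {j : ℕ} (hj : j + 1 < r i) :
    ¬ IsUpdateSlot r (periodStart r i + j + 1) := by
  rintro ⟨k, hk⟩
  rcases le_or_gt k i with h | h
  · have := periodStart_mono r h
    omega
  · have := periodStart_add_le r h
    omega

lemma finSigmaFinEquiv_val {s : ℕ} (r : Fin s → ℕ) (k : (i : Fin s) × Fin (r i)) :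
    (finSigmaFinEquiv k : ℕ) = periodStart r k.1 + k.2 := by
  rw [finSigmaFinEquiv_apply, periodStart]
  congr 1
  refine Finset.sum_bij (fun j _ => Fin.castLE k.1.2.le j) ?_ ?_ ?_ ?_
  · intro j _
    exact Finset.mem_Iio.2 j.2
  · intro a _ b _ h
    exact Fin.castLE_injective _ h
  · intro b hb
    have hb' : b < k.1 := Finset.mem_Iio.1 hb
    exact ⟨⟨b, hb'⟩, Finset.mem_univ _, rfl⟩
  · intro j _
    rfl

lemma exists_eq_periodStart_add {s T : ℕ} {r : Fin s → ℕ} (hT : ∑ i, r i = T) (t : Fin T) :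
    ∃ i, ∃ j < r i, (t : ℕ) = periodStart r i + j := by
  subst hT
  obtain ⟨⟨i, j⟩, rfl⟩ := finSigmaFinEquiv.surjective t
  exact ⟨i, j, j.2, finSigmaFinEquiv_val r _⟩

/-- Sums over the slots are iterated sums over the periods and the slots of each period. -/
lemma sum_slots {s T : ℕ} {r : Fin s → ℕ} (hT : ∑ i, r i = T) (f : ℕ → ℝ) :
    ∑ t : Fin T, f t = ∑ i, ∑ j : Fin (r i), f (periodStart r i + j) := by
  subst hT
  rw [← finSigmaFinEquiv.sum_comp, Fintype.sum_sigma]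
  simp only [finSigmaFinEquiv_val]

/-- Within a period the cache does not change. -/
lemma RestrictedPolicy.cache_eq_cache_periodStart {L C T s : ℕ} {r : Fin s → ℕ} {Ω : Type*}
    [MeasurableSpace Ω] (P : RestrictedPolicy L C T r Ω) (x : Fin T → Fin L) (ω : Ω) (i : Fin s)
    (hp : periodStart r i < T) (j : ℕ) (hj : j < r i) (ht : periodStart r i + j < T) :
    P.cache ⟨periodStart r i + j, ht⟩ (history x ⟨periodStart r i + j, ht⟩) ω =
      P.cache ⟨periodStart r i, hp⟩ (history x ⟨periodStart r i, hp⟩) ω := by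
  induction j with
  | zero => rfl
  | succ j ih =>
    rw [← ih (by omega) (by omega)]
    exact P.hold _ ht (not_isUpdateSlot r i hj) x ω

/-! ### Upper bound for follow the perturbed leader -/

lemma topScore_add_mul_le {L C : ℕ} (hCL : C ≤ L) (v γ : Fin L → ℝ) {δ : ℝ} (hδ : 0 ≤ δ) :
    topScore C (fun i => v i + δ * γ i) ≤ topScore C v + δ * ∑ i, |γ i| := by
  refine (topScore_add_le hCL v fun i => δ * γ i).trans ?_
  rw [← Finset.mul_sum]
  gcongr
  exact (Finset.sum_le_sum fun i _ => le_abs_self (γ i)).trans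
    (Finset.sum_le_univ_sum_of_nonneg fun i => abs_nonneg (γ i))

/-- The be-the-perturbed-leader inequality: the hits of a cache that already knows the current
request, up to the variation of the learning rate. -/
lemma topScore_prefixCount_le {L C : ℕ} (hCL : C ≤ L) (x : ℕ → Fin L) {β : ℕ → ℝ}
    (hβ : Monotone β) (hβ0 : 0 ≤ β 0) (γ : Fin L → ℝ) (n : ℕ) :
    topScore C (fun i => (prefixCount x n i : ℝ) + β n * γ i) ≤ β n * ∑ i, |γ i| +
      ∑ t ∈ Finset.range n,
        if x t ∈ topFiles C (fun i => (prefixCount x (t + 1) i : ℝ) + β t * γ i)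
          then (1 : ℝ) else 0 := by
  induction n with
  | zero =>
    refine (topScore_le_sum_abs _ _).trans_eq ?_
    simp [prefixCount_zero, abs_mul, abs_of_nonneg hβ0, Finset.mul_sum]
  | succ n ih =>
    -- Raising the learning rate costs its increment times `∑ i, |γ i|`; these costs telescope to `β
    -- n`.
    have h1 := topScore_add_mul_le hCL (fun i => (prefixCount x (n + 1) i : ℝ) + β n * γ i) γ
      (sub_nonneg.2 (hβ n.le_succ))
    have e1 : (fun i => (prefixCount x (n + 1) i : ℝ) + β n * γ i + (β (n + 1) - β n) * γ i) =
        fun i => (prefixCount x (n + 1) i : ℝ) + β (n + 1) * γ i := by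
      funext i
      ring
    -- Adding request `n` raises the top score by at most one, and only if the new top set contains
    -- the requested file, which is a hit of the clairvoyant cache.
    have h2 := topScore_add_le hCL (fun i => (prefixCount x n i : ℝ) + β n * γ i)
      fun i => if x n = i then 1 else 0
    have e2 : (fun i => (prefixCount x n i : ℝ) + β n * γ i + if x n = i then 1 else 0) =
        fun i => (prefixCount x (n + 1) i : ℝ) + β n * γ i := by
      funext i
      rw [prefixCount_succ]
      push_cast
      ring
    rw [Nat.succ_eq_add_one, e1] at h1
    rw [e2, Finset.sum_ite_eq] at h2
    rw [Finset.sum_range_succ]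
    linarith

/-! ### Stability of the top files under a Gaussian perturbation -/

lemma gaussianReal_le_volume (s : Set ℝ) :
    gaussianReal 0 1 s ≤ ENNReal.ofReal (√(2 * Real.pi))⁻¹ * volume s := by
  rw [gaussianReal_of_var_ne_zero _ one_ne_zero, withDensity_apply' _ s]
  refine (lintegral_mono (g := fun _ => ENNReal.ofReal (√(2 * Real.pi))⁻¹) fun y => ?_).trans_eq
    (setLIntegral_const _ _)
  refine ENNReal.ofReal_le_ofReal ?_
  rw [gaussianPDFReal]
  simp only [NNReal.coe_one, mul_one]
  refine mul_le_of_le_one_right (by positivity) (Real.exp_le_one_iff.2 ?_)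
  rw [neg_div]
  exact neg_nonpos.2 (by positivity)

/-- A set of reals of diameter at most `ℓ` has standard normal measure at most `ℓ / √(2π)`. -/
lemma gaussianReal_le_of_sub_le {s : Set ℝ} {ℓ : ℝ} (h : ∀ a ∈ s, ∀ b ∈ s, b ≤ a + ℓ) :
    gaussianReal 0 1 s ≤ ENNReal.ofReal ((√(2 * Real.pi))⁻¹ * ℓ) := by
  refine (gaussianReal_le_volume s).trans ?_
  rw [ENNReal.ofReal_mul (by positivity)]
  gcongr
  refine (Real.volume_le_diam s).trans (Metric.ediam_le fun a ha b hb => ?_)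
  rw [edist_dist, Real.dist_eq]
  refine ENNReal.ofReal_le_ofReal (abs_le.2 ⟨?_, ?_⟩)
  · linarith [h a ha b hb]
  · linarith [h b hb a ha]

/-- A set all of whose fibres in the direction of a coordinate have small measure is small. -/
lemma pi_le_of_forall_update_le {L : ℕ} (ν : Measure ℝ) [IsProbabilityMeasure ν] (k : Fin L)
    {D : Set (Fin L → ℝ)} (hD : MeasurableSet D) {c : ENNReal}
    (h : ∀ γ : Fin L → ℝ, ν {g | Function.update γ k g ∈ D} ≤ c) :
    Measure.pi (fun _ : Fin L => ν) D ≤ c := by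
  cases L with
  | zero => exact k.elim0
  | succ n =>
    -- Fubini: coordinate `k` is split off and integrated first.
    have hm := measurePreserving_piFinSuccAbove (fun _ : Fin (n + 1) => ν) k
    have hm' := hm.symm
    rw [← hm'.measure_preimage hD.nullMeasurableSet,
      Measure.prod_apply_symm (hm'.measurable hD)]
    refine (lintegral_mono (g := fun _ => c) fun y => ?_).trans_eq (by simp)
    refine le_trans (le_of_eq ?_) (h (k.insertNth 0 y))
    congr 1
    ext g
    simp only [Fin.update_insertNth]
    rfl

instance isProbabilityMeasure_stdNormal (L : ℕ) : IsProbabilityMeasure (stdNormal L) := by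
  unfold stdNormal
  infer_instance

lemma measurableSet_mem_topFiles_add_mul {L : ℕ} (C : ℕ) (v : Fin L → ℝ) (η : ℝ) (k : Fin L) :
    MeasurableSet {γ : Fin L → ℝ | k ∈ topFiles C fun i => v i + η * γ i} := by
  have hm : Measurable fun γ : Fin L → ℝ => fun i => v i + η * γ i := by fun_prop
  exact hm (measurableSet_mem_topFiles C k)

/-- With the other coordinates of `γ` fixed, the values of `γ k` that put `k` in the top for `w` but
not for `v` have diameter at most `d / η`: a larger increase of `γ k` makes up for the drop from `w
k` to `v k`, while the other scores only fall. -/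
lemma measureReal_mem_topFiles_sub_le {L C : ℕ} {η d : ℝ} (hη : 0 < η) {v w : Fin L → ℝ}
    (hvw : ∀ i, v i ≤ w i) (k : Fin L) (hd : w k ≤ v k + d) :
    (stdNormal L).real {γ | k ∈ topFiles C fun i => w i + η * γ i} -
        (stdNormal L).real {γ | k ∈ topFiles C fun i => v i + η * γ i} ≤
      (√(2 * Real.pi))⁻¹ * (d / η) := by
  have hd0 : 0 ≤ d := by linarith [hvw k]
  refine (le_measureReal_sdiff).trans ?_
  refine ENNReal.toReal_le_of_le_ofReal (by positivity) ?_
  refine pi_le_of_forall_update_le _ k ((measurableSet_mem_topFiles_add_mul C w η k).diff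
    (measurableSet_mem_topFiles_add_mul C v η k)) fun γ => ?_
  refine gaussianReal_le_of_sub_le fun a ha b hb => ?_
  by_contra! hab
  refine hb.2 (mem_topFiles_mono ?_ ?_ ha.1)
  · simp only [Function.update_self]
    have : η * (a + d / η) < η * b := by gcongr
    rw [mul_add, mul_div_cancel₀ _ hη.ne'] at this
    linarith
  · intro j hj
    simp only [Function.update_of_ne hj]
    linarith [hvw j]

lemma integral_ite_one_zero {Ω : Type*} [MeasurableSpace Ω] (μ : Measure Ω) {p : Ω → Prop}
    [DecidablePred p] (hp : MeasurableSet {ω | p ω}) :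
    ∫ ω, (if p ω then (1 : ℝ) else 0) ∂μ = μ.real {ω | p ω} := by
  rw [← integral_indicator_one hp]
  congr 1
  funext ω
  by_cases h : p ω <;> simp [h]

/-- The last period start that is at most `n`. -/
def lastUpdate {s : ℕ} (r : Fin s → ℕ) (n : ℕ) : ℕ :=
  (Finset.univ.filter fun i => periodStart r i ≤ n).sup (periodStart r)

lemma lastUpdate_mono {s : ℕ} (r : Fin s → ℕ) : Monotone (lastUpdate r) := fun _ _ h =>
  Finset.sup_mono (Finset.monotone_filter_right _ fun _ _ hi => le_trans hi h)

lemma lastUpdate_periodStart_add {s : ℕ} (r : Fin s → ℕ) (i : Fin s) {j : ℕ} (hj : j < r i) :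
    lastUpdate r (periodStart r i + j) = periodStart r i := by
  refine le_antisymm (Finset.sup_le fun k hk => ?_) (Finset.le_sup (f := periodStart r) ?_)
  · have hk' := (Finset.mem_filter.1 hk).2
    rcases le_or_gt k i with h | h
    · exact periodStart_mono r h
    · have := periodStart_add_le r h
      omega
  · simp

lemma lastUpdate_lt {s T : ℕ} {r : Fin s → ℕ} (hr : ∀ i, 1 ≤ r i) (hT : ∑ i, r i = T)
    (hT0 : 0 < T) (n : ℕ) : lastUpdate r n < T := by
  refine (Finset.sup_lt_iff (by simpa using hT0)).2 fun i _ => ?_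
  have := periodStart_add_le_sum r i
  have := hr i
  omega

lemma ftplCache_of_isUpdateSlot {L s : ℕ} (C : ℕ) {r : Fin s → ℕ} (η : ℕ → ℝ) {t : ℕ}
    (ht : IsUpdateSlot r t) (h : Fin t → Fin L) (γ : Fin L → ℝ) :
    ftplCache C r η t h γ = topFiles C (perturbedCount (η (t + 1)) h γ) := by
  cases t with
  | zero => rfl
  | succ t => rw [ftplCache, if_pos ht]

/-- Replaces the recursive cache by a single top set, with counts and learning rate frozen at the
last update. -/
lemma ftpl_cache_eq {L C T s : ℕ} {r : Fin s → ℕ} (hT : ∑ i, r i = T) (η : ℕ → ℝ)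
    (x : Fin T → Fin L) {y : ℕ → Fin L} (hxy : ∀ t : Fin T, x t = y t) (t : Fin T)
    (γ : Fin L → ℝ) :
    (ftpl L C T r η).cache t (history x t) γ =
      topFiles C fun i => (prefixCount y (lastUpdate r t) i : ℝ) +
        η (lastUpdate r t + 1) * γ i := by
  obtain ⟨i, j, hj, htj⟩ := exists_eq_periodStart_add hT t
  obtain ⟨t, ht⟩ := t
  dsimp only at htj
  subst htj
  rw [(ftpl L C T r η).cache_eq_cache_periodStart x γ i (by omega) j hj,
    lastUpdate_periodStart_add r i hj]
  refine (ftplCache_of_isUpdateSlot C η ⟨i, rfl⟩ _ γ).trans ?_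
  congr 1
  funext k
  rw [perturbedCount, requestCount_eq_prefixCount _ y]
  exact fun _ => hxy _

/-- Expected total absolute perturbation. -/
def meanAbsPerturbation (L : ℕ) : ℝ := ∫ γ, ∑ i, |γ i| ∂(stdNormal L)

lemma integrable_sum_abs_stdNormal (L : ℕ) :
    Integrable (fun γ : Fin L → ℝ => ∑ i, |γ i|) (stdNormal L) := by
  refine integrable_finsetSum _ fun i _ => Integrable.abs ?_
  have h : Integrable (fun g : ℝ => g) (gaussianReal 0 1) :=
    (memLp_id_gaussianReal 1).integrable (by simp)
  exact (measurePreserving_eval (fun _ : Fin L => gaussianReal 0 1) i).integrable_comp_of_integrable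
    h

/-- The best static cache against the cache that already knows the current request. -/
lemma bestStaticHits_le {L C T : ℕ} (hCL : C ≤ L) (x : Fin T → Fin L) {y : ℕ → Fin L}
    (hxy : ∀ t : Fin T, x t = y t) {β : ℕ → ℝ} (hβ : Monotone β) (hβ0 : 0 ≤ β 0) :
    bestStaticHits C x ≤ 2 * β T * meanAbsPerturbation L +
      ∑ t : Fin T, (stdNormal L).real
        {γ | y t ∈ topFiles C fun i => (prefixCount y (t + 1) i : ℝ) + β t * γ i} := by
  classical
  have : Nonempty {S : Finset (Fin L) // S.card ≤ C} := ⟨⟨∅, by simp⟩⟩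
  refine ciSup_le fun ⟨S, hS⟩ => ?_
  -- The comparison with `topScore` needs exactly `C` files; counts are nonnegative, so enlarging
  -- `S` loses nothing.
  obtain ⟨S', hSS', -, hS'⟩ := Finset.exists_subsuperset_card_eq (Finset.subset_univ S) hS
    (by simpa using hCL)
  refine (Finset.sum_le_sum_of_subset_of_nonneg hSS' fun _ _ _ => by positivity).trans ?_
  have hβT : 0 ≤ β T := hβ0.trans (hβ T.zero_le)
  -- One `β T` comes from the telescoped learning rates, the other from removing the perturbation
  -- from the score of `S'`.
  have hpt : ∀ γ : Fin L → ℝ, ∑ i ∈ S', (requestCount x i : ℝ) ≤ 2 * β T * ∑ i, |γ i| +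
      ∑ t : Fin T, if y t ∈ topFiles C (fun i => (prefixCount y (t + 1) i : ℝ) + β t * γ i)
          then (1 : ℝ) else 0 := by
    intro γ
    have h1 := topScore_prefixCount_le hCL y hβ hβ0 γ T
    have h2 := sum_le_topScore hCL (fun i => (prefixCount y T i : ℝ) + β T * γ i) hS'
    rw [Finset.sum_add_distrib, ← Finset.mul_sum] at h2
    have h3 : -∑ i, |γ i| ≤ ∑ i ∈ S', γ i :=
      (neg_le_neg (Finset.sum_le_univ_sum_of_nonneg fun i => abs_nonneg (γ i))).trans
        (neg_le_of_abs_le (Finset.abs_sum_le_sum_abs γ S'))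
    have h4 := mul_le_mul_of_nonneg_left h3 hβT
    rw [← Fin.sum_univ_eq_sum_range (fun t =>
      if y t ∈ topFiles C (fun i => (prefixCount y (t + 1) i : ℝ) + β t * γ i)
          then (1 : ℝ) else 0) T] at h1
    simp only [requestCount_eq_prefixCount x y hxy]
    linarith
  have hmeas : ∀ t : Fin T, MeasurableSet
      {γ : Fin L → ℝ | y t ∈ topFiles C fun i => (prefixCount y (t + 1) i : ℝ) + β t * γ i} :=
    fun t => measurableSet_mem_topFiles_add_mul C _ _ _
  have hint : ∀ t : Fin T, Integrable (fun γ : Fin L → ℝ =>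
      if y t ∈ topFiles C (fun i => (prefixCount y (t + 1) i : ℝ) + β t * γ i)
        then (1 : ℝ) else 0) (stdNormal L) := by
    intro t
    refine Integrable.of_bound (Measurable.ite (hmeas t) measurable_const
      measurable_const).aestronglyMeasurable 1 (Filter.Eventually.of_forall fun γ => ?_)
    split_ifs <;> simp
  have hmono := integral_mono (integrable_const _)
    (((integrable_sum_abs_stdNormal L).const_mul (2 * β T)).add
      (integrable_finsetSum Finset.univ fun t _ => hint t)) hpt
  rw [integral_const, probReal_univ, one_smul] at hmono
  refine hmono.trans_eq ?_
  simp only [Pi.add_apply]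
  rw [integral_add ((integrable_sum_abs_stdNormal L).const_mul _)
    (integrable_finsetSum _ fun t _ => hint t), integral_const_mul,
    integral_finsetSum _ fun t _ => hint t]
  congr 1
  exact Finset.sum_congr rfl fun t _ => integral_ite_one_zero _ (hmeas t)

lemma inv_sqrt_two_mul_pi_le : (√(2 * Real.pi))⁻¹ ≤ √(2 / Real.pi) := by
  rw [← Real.sqrt_inv]
  refine Real.sqrt_le_sqrt ?_
  rw [mul_inv, div_eq_mul_inv]
  gcongr
  norm_num

theorem ftpl_regretOn_le {L C : ℕ} (hCL : C ≤ L) {T s : ℕ} {r : Fin s → ℕ}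
    (hr : ∀ i, 1 ≤ r i) (hT : ∑ i, r i = T) (hT0 : 0 < T) {α : ℝ} (hα : 0 < α)
    (x : Fin T → Fin L) :
    (ftpl L C T r (fun t => α * √(t : ℝ))).regretOn (stdNormal L) x ≤
      2 * meanAbsPerturbation L * (α * √(T : ℝ)) +
        √(2 / Real.pi) *
          ∑ i, (r i : ℝ) ^ 2 / (α * √(1 + ∑ j ∈ Finset.Iio i, (r j : ℝ))) := by
  -- The values of `y` from `T` on are arbitrary and never affect the counts used.
  set y : ℕ → Fin L := fun t => if h : t < T then x ⟨t, h⟩ else x ⟨0, hT0⟩ with hy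
  have hxy : ∀ t : Fin T, x t = y t := fun t => by simp [hy]
  set β : ℕ → ℝ := fun n => α * √((lastUpdate r n + 1 : ℕ) : ℝ) with hβ
  have hβmono : Monotone β := fun m n h => by
    have := lastUpdate_mono r h
    simp only [hβ]
    gcongr
  have hβpos : ∀ n, 0 < β n := fun n => by
    simp only [hβ]
    positivity
  have hbest := bestStaticHits_le hCL x hxy hβmono (hβpos 0).le
  have hK : 0 ≤ meanAbsPerturbation L :=
    integral_nonneg fun γ => Finset.sum_nonneg fun i _ => abs_nonneg _
  have hβT : β T ≤ α * √(T : ℝ) := by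
    simp only [hβ]
    gcongr
    -- Every period is nonempty, so even the last update lies before `T`, and its rate is at most `α
    -- √T`.
    exact lastUpdate_lt hr hT hT0 T
  have hhits : ∀ t : Fin T, ∫ γ, (if x t ∈
      (ftpl L C T r (fun t => α * √(t : ℝ))).cache t (history x t) γ then (1 : ℝ) else 0)
        ∂(stdNormal L) = (stdNormal L).real {γ | y t ∈ topFiles C fun i =>
          (prefixCount y (lastUpdate r t) i : ℝ) + β t * γ i} := by
    intro t
    rw [integral_ite_one_zero _ ((ftpl L C T r _).measurableSet_mem t _ _)]
    simp only [ftpl_cache_eq hT _ x hxy t, hxy t, hβ]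
  have hslots : ∑ t : Fin T, ((stdNormal L).real
        {γ | y t ∈ topFiles C fun i => (prefixCount y (t + 1) i : ℝ) + β t * γ i} -
      (stdNormal L).real {γ | y t ∈ topFiles C fun i =>
          (prefixCount y (lastUpdate r t) i : ℝ) + β t * γ i}) ≤
      √(2 / Real.pi) *
          ∑ i, (r i : ℝ) ^ 2 / (α * √(1 + ∑ j ∈ Finset.Iio i, (r j : ℝ))) := by
    rw [sum_slots hT fun t => (stdNormal L).real
        {γ | y t ∈ topFiles C fun i => (prefixCount y (t + 1) i : ℝ) + β t * γ i} -
      (stdNormal L).real {γ | y t ∈ topFiles C fun i =>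
          (prefixCount y (lastUpdate r t) i : ℝ) + β t * γ i}, Finset.mul_sum]
    refine Finset.sum_le_sum fun i _ => ?_
    have hβi : ∀ j < r i, β (periodStart r i + j) =
        α * √(1 + ∑ j ∈ Finset.Iio i, (r j : ℝ)) := by
      intro j hj
      simp only [hβ, lastUpdate_periodStart_add r i hj]
      simp only [periodStart]
      push_cast
      rw [add_comm]
    have hterm : ∀ j : Fin (r i), (stdNormal L).real {γ | y (periodStart r i + j) ∈ topFiles C
          fun k => (prefixCount y (periodStart r i + j + 1) k : ℝ) +
            β (periodStart r i + j) * γ k} -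
        (stdNormal L).real {γ | y (periodStart r i + j) ∈ topFiles C fun k =>
          (prefixCount y (lastUpdate r (periodStart r i + j)) k : ℝ) +
            β (periodStart r i + j) * γ k} ≤
        √(2 / Real.pi) * (r i / (α * √(1 + ∑ j ∈ Finset.Iio i, (r j : ℝ)))) := by
      intro j
      rw [lastUpdate_periodStart_add r i j.2]
      -- From the start of period `i` through its slot `j` there are `j + 1 ≤ r i` requests.
      refine (measureReal_mem_topFiles_sub_le (d := r i) (hβpos _) (fun k => ?_) _ ?_).trans ?_
      · exact_mod_cast prefixCount_mono y (by omega) k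
      · have h1 := prefixCount_add_le y (periodStart r i) (j + 1) (y (periodStart r i + j))
        have h2 := j.2
        rw [← add_assoc] at h1
        exact_mod_cast h1.trans (by omega)
      · rw [hβi j j.2]
        gcongr
        exact inv_sqrt_two_mul_pi_le
    refine (Finset.sum_le_sum fun j _ => hterm j).trans_eq ?_
    rw [Finset.sum_const, Finset.card_univ, Fintype.card_fin, nsmul_eq_mul]
    ring
  rw [RestrictedPolicy.regretOn, Finset.sum_congr rfl fun t _ => hhits t]
  rw [Finset.sum_sub_distrib] at hslots
  have := mul_le_mul_of_nonneg_left hβT hK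
  linarith

/-! ### Lower bound for arbitrary policies -/

/-- Moments up to order four of a weighted sum of independent symmetric variables that take the
values `1` and `-1` with probability `1 / (2 c)` each, and the value `0` otherwise. -/
lemma sum_weightedSum_moments {Z : Type*} [Fintype Z] {ξ : Z → ℝ} {c : ℝ} (hc : c ≠ 0)
    (hZ : (Fintype.card Z : ℝ) = 2 * c) (h1 : ∑ z, ξ z = 0) (h2 : ∑ z, ξ z ^ 2 = 2)
    (h3 : ∑ z, ξ z ^ 3 = 0) (h4 : ∑ z, ξ z ^ 4 = 2) (s : ℕ) (r : Fin s → ℝ) :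
    (∑ y : Fin s → Z, ∑ i, r i * ξ (y i) = 0 ∧ ∑ y : Fin s → Z, (∑ i, r i * ξ (y i)) ^ 3 = 0) ∧
    ∑ y : Fin s → Z, (∑ i, r i * ξ (y i)) ^ 2 = (2 * c) ^ s * ((∑ i, r i ^ 2) / c) ∧
    ∑ y : Fin s → Z, (∑ i, r i * ξ (y i)) ^ 4 =
      (2 * c) ^ s * ((∑ i, r i ^ 4) / c + 3 * ((∑ i, r i ^ 2) ^ 2 - ∑ i, r i ^ 4) / c ^ 2) := by
  induction s with
  | zero => simp
  | succ s ih =>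
    obtain ⟨⟨i1, i3⟩, i2, i4⟩ := ih fun i => r i.succ
    have hN : ∑ _y : Fin s → Z, (1 : ℝ) = (2 * c) ^ s := by
      simp [← hZ]
    have hstep : ∀ p : ℕ, ∑ y : Fin (s + 1) → Z, (∑ i, r i * ξ (y i)) ^ p =
        ∑ z, ∑ y : Fin s → Z, (r 0 * ξ z + ∑ i, r i.succ * ξ (y i)) ^ p := by
      intro p
      rw [← (Fin.consEquiv fun _ : Fin (s + 1) => Z).sum_comp, Fintype.sum_prod_type]
      simp [Fin.sum_univ_succ, Fin.consEquiv]
    have hZ1 : ∑ _z : Z, (1 : ℝ) = 2 * c := by simp [hZ]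
    generalize hD : (fun y : Fin s → Z => ∑ i, r i.succ * ξ (y i)) = D at *
    have hD' : ∀ y : Fin s → Z, ∑ i, r i.succ * ξ (y i) = D y := fun y => congrFun hD y
    simp only [hD'] at i1 i2 i3 i4 hstep
    -- Binomial expansions for the first block fixed at `a = r 0 * ξ z`; the odd moments of the
    -- remaining blocks vanish. All moments are unnormalised sums over words.
    have e1 : ∀ a : ℝ, ∑ y, (a + D y) ^ 1 = (2 * c) ^ s * a := by
      intro a
      calc ∑ y, (a + D y) ^ 1 = a * ∑ _y : Fin s → Z, (1 : ℝ) + ∑ y, D y := by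
            rw [Finset.mul_sum, ← Finset.sum_add_distrib]
            exact Finset.sum_congr rfl fun y _ => by ring
        _ = _ := by rw [hN, i1]; ring
    have e2 : ∀ a : ℝ, ∑ y, (a + D y) ^ 2 = (2 * c) ^ s * a ^ 2 + ∑ y, D y ^ 2 := by
      intro a
      calc ∑ y, (a + D y) ^ 2
          = a ^ 2 * ∑ _y : Fin s → Z, (1 : ℝ) + 2 * a * ∑ y, D y + ∑ y, D y ^ 2 := by
            rw [Finset.mul_sum, Finset.mul_sum, ← Finset.sum_add_distrib,
              ← Finset.sum_add_distrib]
            exact Finset.sum_congr rfl fun y _ => by ring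
        _ = _ := by rw [hN, i1]; ring
    have e3 : ∀ a : ℝ, ∑ y, (a + D y) ^ 3 =
        (2 * c) ^ s * a ^ 3 + 3 * a * ∑ y, D y ^ 2 := by
      intro a
      calc ∑ y, (a + D y) ^ 3
          = a ^ 3 * ∑ _y : Fin s → Z, (1 : ℝ) + 3 * a ^ 2 * ∑ y, D y + 3 * a * ∑ y, D y ^ 2
            + ∑ y, D y ^ 3 := by
            rw [Finset.mul_sum, Finset.mul_sum, Finset.mul_sum, ← Finset.sum_add_distrib,
              ← Finset.sum_add_distrib, ← Finset.sum_add_distrib]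
            exact Finset.sum_congr rfl fun y _ => by ring
        _ = _ := by rw [hN, i1, i3]; ring
    have e4 : ∀ a : ℝ, ∑ y, (a + D y) ^ 4 =
        (2 * c) ^ s * a ^ 4 + 6 * a ^ 2 * ∑ y, D y ^ 2 + ∑ y, D y ^ 4 := by
      intro a
      calc ∑ y, (a + D y) ^ 4
          = a ^ 4 * ∑ _y : Fin s → Z, (1 : ℝ) + 4 * a ^ 3 * ∑ y, D y + 6 * a ^ 2 * ∑ y, D y ^ 2
            + 4 * a * ∑ y, D y ^ 3 + ∑ y, D y ^ 4 := by
            rw [Finset.mul_sum, Finset.mul_sum, Finset.mul_sum, Finset.mul_sum,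
              ← Finset.sum_add_distrib, ← Finset.sum_add_distrib, ← Finset.sum_add_distrib,
              ← Finset.sum_add_distrib]
            exact Finset.sum_congr rfl fun y _ => by ring
        _ = _ := by rw [hN, i1, i3]; ring
    have hstep1 := hstep 1
    simp only [pow_one] at hstep1 e1
    generalize ∑ y, D y ^ 2 = A at *
    generalize ∑ y, D y ^ 4 = B at *
    refine ⟨⟨?_, ?_⟩, ?_, ?_⟩
    · rw [hstep1]
      simp only [e1]
      rw [← Finset.mul_sum, ← Finset.mul_sum, h1]
      ring
    · rw [hstep 3]
      simp only [e3]
      calc ∑ z, ((2 * c) ^ s * (r 0 * ξ z) ^ 3 + 3 * (r 0 * ξ z) * A)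
          = (2 * c) ^ s * r 0 ^ 3 * ∑ z, ξ z ^ 3 + 3 * r 0 * A * ∑ z, ξ z := by
            rw [Finset.mul_sum, Finset.mul_sum, ← Finset.sum_add_distrib]
            exact Finset.sum_congr rfl fun y _ => by ring
        _ = 0 := by rw [h3, h1]; ring
    · rw [hstep 2]
      simp only [e2]
      calc ∑ z, ((2 * c) ^ s * (r 0 * ξ z) ^ 2 + A)
          = (2 * c) ^ s * r 0 ^ 2 * ∑ z, ξ z ^ 2 + A * ∑ _z : Z, (1 : ℝ) := by
            rw [Finset.mul_sum, Finset.mul_sum, ← Finset.sum_add_distrib]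
            exact Finset.sum_congr rfl fun y _ => by ring
        _ = _ := by
            rw [h2, hZ1, i2, Fin.sum_univ_succ]
            field_simp
            ring
    · rw [hstep 4]
      simp only [e4]
      calc ∑ z, ((2 * c) ^ s * (r 0 * ξ z) ^ 4 + 6 * (r 0 * ξ z) ^ 2 * A
            + B)
          = (2 * c) ^ s * r 0 ^ 4 * ∑ z, ξ z ^ 4 + 6 * r 0 ^ 2 * A * ∑ z, ξ z ^ 2
            + B * ∑ _z : Z, (1 : ℝ) := by
            rw [Finset.mul_sum, Finset.mul_sum, Finset.mul_sum, ← Finset.sum_add_distrib,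
              ← Finset.sum_add_distrib]
            exact Finset.sum_congr rfl fun y _ => by ring
        _ = _ := by
            rw [h2, h4, hZ1, i2, i4, Fin.sum_univ_succ, Fin.sum_univ_succ]
            field_simp
            ring

/-- Lower bound for the first absolute moment in terms of the second and fourth moments. -/
lemma sq_sub_fourth_le_abs {σ : ℝ} (hσ : 0 ≤ σ) (d : ℝ) :
    27 * σ ^ 2 * d ^ 2 - d ^ 4 ≤ 54 * σ ^ 3 * |d| := by
  -- The double root at `3 * σ` gives tangency, and the factor `|d| + 6 * σ` cancels the cubic term.
  have h : 0 ≤ |d| * (|d| - 3 * σ) ^ 2 * (|d| + 6 * σ) := by positivity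
  have h2 : d ^ 2 = |d| ^ 2 := (sq_abs d).symm
  have h4 : d ^ 4 = |d| ^ 4 := by rw [show d ^ 4 = (d ^ 2) ^ 2 by ring, h2]; ring
  rw [h2, h4]
  linarith

/-- The pointwise inequality is summed over all words with `σ ^ 2` equal to the mean second moment,
so the right side is `54 * σ ^ 3` times the sum of absolute values. -/
lemma le_sum_abs_weightedSum {Z : Type*} [Fintype Z] {ξ : Z → ℝ} {c : ℝ} (hc : 1 ≤ c)
    (hZ : (Fintype.card Z : ℝ) = 2 * c) (h1 : ∑ z, ξ z = 0) (h2 : ∑ z, ξ z ^ 2 = 2)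
    (h3 : ∑ z, ξ z ^ 3 = 0) (h4 : ∑ z, ξ z ^ 4 = 2) {s : ℕ} (r : Fin s → ℝ)
    (hr : 0 < ∑ i, r i ^ 2) :
    (2 * c) ^ s * (√((∑ i, r i ^ 2) / c) *
        (0.15 * (1 - (c - 1) * (∑ i, r i ^ 4) / (2 * (∑ i, r i ^ 2) ^ 2)))) ≤
      ∑ y : Fin s → Z, |∑ i, r i * ξ (y i)| := by
  have hc0 : 0 < c := by linarith
  obtain ⟨-, m2, m4⟩ := sum_weightedSum_moments hc0.ne' hZ h1 h2 h3 h4 s r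
  set Q := ∑ i, r i ^ 2
  have hF : 0 ≤ ∑ i, r i ^ 4 := Finset.sum_nonneg fun i _ => by positivity
  set F := ∑ i, r i ^ 4
  set σ := √(Q / c)
  have hσ : 0 < σ := Real.sqrt_pos.2 (by positivity)
  have hσ2 : σ ^ 2 = Q / c := Real.sq_sqrt (by positivity)
  have hQ : Q = σ ^ 2 * c := by rw [hσ2]; field_simp
  have hsum := Finset.sum_le_sum fun (y : Fin s → Z) (_ : y ∈ Finset.univ) =>
    sq_sub_fourth_le_abs hσ.le (∑ i, r i * ξ (y i))
  rw [Finset.sum_sub_distrib, ← Finset.mul_sum, ← Finset.mul_sum, m2, m4] at hsum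
  have hpos : 0 < 54 * σ ^ 3 := by positivity
  refine le_of_mul_le_mul_left (le_trans ?_ hsum) hpos
  have hN : 0 < (2 * c) ^ s := by positivity
  generalize (2 * c) ^ s = N at *
  rw [hQ]
  -- Here `8.1 = 54 * 0.15` and `4.05 = 8.1 / 2`; the difference is the slack, nonnegative since `c
  -- ≥ 1`.
  have key : N * (27 * σ ^ 4 - (F / c + 3 * ((σ ^ 2 * c) ^ 2 - F) / c ^ 2)) -
      N * (8.1 * σ ^ 4 - 4.05 * (c - 1) * F / c ^ 2) =
      N * (15.9 * σ ^ 4 + (3.05 * (c - 1) + 2) * F / c ^ 2) := by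
    field_simp
    ring
  have key0 : 0 ≤ N * (15.9 * σ ^ 4 + (3.05 * (c - 1) + 2) * F / c ^ 2) := by
    have : 0 ≤ c - 1 := by linarith
    positivity
  have e1 : 54 * σ ^ 3 * (N * (σ * (0.15 * (1 - (c - 1) * F / (2 * (σ ^ 2 * c) ^ 2))))) =
      N * (8.1 * σ ^ 4 - 4.05 * (c - 1) * F / c ^ 2) := by
    field_simp
    ring
  have e2 : 27 * σ ^ 2 * (N * (σ ^ 2 * c / c)) -
      N * (F / c + 3 * ((σ ^ 2 * c) ^ 2 - F) / c ^ 2) =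
      N * (27 * σ ^ 4 - (F / c + 3 * ((σ ^ 2 * c) ^ 2 - F) / c ^ 2)) := by
    field_simp
  linarith

/-! ### Random block requests -/

/-- Resampling one coordinate of a uniformly distributed word. -/
lemma sum_sum_update {ι Z : Type*} [Fintype ι] [DecidableEq ι] [Fintype Z] (i : ι)
    (g : (ι → Z) → ℝ) :
    ∑ y : ι → Z, ∑ z, g (Function.update y i z) = Fintype.card Z * ∑ y, g y := by
  -- Swapping coordinate `i` with the fresh letter is an involution.
  let e : (ι → Z) × Z ≃ (ι → Z) × Z :=
    { toFun := fun p => (Function.update p.1 i p.2, p.1 i)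
      invFun := fun p => (Function.update p.1 i p.2, p.1 i)
      left_inv := fun p => by simp
      right_inv := fun p => by simp }
  rw [← Fintype.sum_prod_type' fun y z => g (Function.update y i z)]
  refine (e.sum_comp fun p => g p.1).trans ?_
  rw [Fintype.sum_prod_type]
  simp [Finset.mul_sum]

/-- The period that contains slot `t`. -/
def periodIndex {s : ℕ} (r : Fin s → ℕ) (t : Fin (∑ i, r i)) : Fin s :=
  (finSigmaFinEquiv.symm t).1

lemma eq_periodStart_add {s : ℕ} (r : Fin s → ℕ) (t : Fin (∑ i, r i)) :
    ∃ j < r (periodIndex r t), (t : ℕ) = periodStart r (periodIndex r t) + j := by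
  refine ⟨(finSigmaFinEquiv.symm t).2, (finSigmaFinEquiv.symm t).2.2, ?_⟩
  rw [periodIndex, ← finSigmaFinEquiv_val, Equiv.apply_symm_apply]

lemma periodIndex_lt {s : ℕ} (r : Fin s → ℕ) {t : Fin (∑ i, r i)} {i : Fin s}
    (h : (t : ℕ) < periodStart r i) : periodIndex r t < i := by
  by_contra! hle
  obtain ⟨j, -, hj⟩ := eq_periodStart_add r t
  have := periodStart_mono r hle
  omega

/-- The request sequence that repeats the file `f (y i)` throughout period `i`. -/
def blockRequests {L s : ℕ} (r : Fin s → ℕ) {Z : Type*} (f : Z → Fin L) (y : Fin s → Z) :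
    Fin (∑ i, r i) → Fin L := fun t => f (y (periodIndex r t))

/-- The cache is frozen since the start of its period, where the history shows only earlier blocks;
this is its independence of the current block. -/
lemma cache_blockRequests_congr {L C s : ℕ} {r : Fin s → ℕ} {Ω : Type*} [MeasurableSpace Ω]
    (P : RestrictedPolicy L C (∑ i, r i) r Ω) {Z : Type*} (f : Z → Fin L) {y y' : Fin s → Z}
    (t : Fin (∑ i, r i)) (h : ∀ i < periodIndex r t, y i = y' i) (ω : Ω) :
    P.cache t (history (blockRequests r f y) t) ω =
      P.cache t (history (blockRequests r f y') t) ω := by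
  obtain ⟨j, hj, htj⟩ := eq_periodStart_add r t
  generalize hi : periodIndex r t = i at *
  obtain ⟨t, ht⟩ := t
  dsimp only at htj
  subst htj
  rw [P.cache_eq_cache_periodStart _ ω i (by omega) j hj,
    P.cache_eq_cache_periodStart _ ω i (by omega) j hj]
  congr 1
  funext k
  simp only [history, blockRequests]
  rw [h _ (periodIndex_lt r _)]
  exact k.2

/-- Against uniformly random blocks from `2 C` files, a cache of `C` files misses half of the
requests on average. -/
lemma two_mul_sum_hits_le {L C s : ℕ} (hC : 1 ≤ C) {r : Fin s → ℕ} {Ω : Type*}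
    [MeasurableSpace Ω] (P : RestrictedPolicy L C (∑ i, r i) r Ω) {Z : Type*} [Fintype Z]
    (hZ : Fintype.card Z = 2 * C) {f : Z → Fin L} (hf : Function.Injective f)
    (t : Fin (∑ i, r i)) (ω : Ω) :
    2 * ∑ y : Fin s → Z, (if blockRequests r f y t ∈
      P.cache t (history (blockRequests r f y) t) ω then (1 : ℝ) else 0) ≤ (2 * C) ^ s := by
  classical
  -- Resampling the current block leaves the cache unchanged, so by injectivity of `f` at most `C`
  -- of the `2 * C` letters give a hit.
  have h := sum_sum_update (periodIndex r t) fun y : Fin s → Z => if blockRequests r f y t ∈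
    P.cache t (history (blockRequests r f y) t) ω then (1 : ℝ) else 0
  have hle : ∀ y : Fin s → Z, ∑ z, (if blockRequests r f
      (Function.update y (periodIndex r t) z) t ∈ P.cache t (history (blockRequests r f
        (Function.update y (periodIndex r t) z)) t) ω then (1 : ℝ) else 0) ≤ C := by
    intro y
    have e : ∀ z, (if blockRequests r f
      (Function.update y (periodIndex r t) z) t ∈ P.cache t (history (blockRequests r f
        (Function.update y (periodIndex r t) z)) t) ω then (1 : ℝ) else 0) =
        if f z ∈ P.cache t (history (blockRequests r f y) t) ω then (1 : ℝ) else 0 := by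
      intro z
      rw [cache_blockRequests_congr P f (y' := y) t
        fun i hi => Function.update_of_ne hi.ne _ _]
      simp [blockRequests]
    rw [Finset.sum_congr rfl fun z _ => e z, ← Finset.sum_filter, Finset.sum_const, nsmul_eq_mul,
      mul_one]
    exact_mod_cast (Finset.card_le_card_of_injOn f (fun z hz => (Finset.mem_filter.1 hz).2)
      hf.injOn).trans (P.card_le t _ ω)
  have h2 := Finset.sum_le_sum fun (y : Fin s → Z) (_ : y ∈ Finset.univ) => hle y
  rw [h, Finset.sum_const, Finset.card_univ, Fintype.card_fun, Fintype.card_fin, hZ,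
    nsmul_eq_mul] at h2
  push_cast at h2
  have hC0 : (0 : ℝ) < C := by exact_mod_cast hC
  refine le_of_mul_le_mul_left ?_ hC0
  linarith

lemma requestCount_blockRequests {L s : ℕ} (r : Fin s → ℕ) {Z : Type*} [DecidableEq Z]
    {f : Z → Fin L} (hf : Function.Injective f) (y : Fin s → Z) (z : Z) :
    (requestCount (blockRequests r f y) (f z) : ℝ) =
      ∑ i, (r i : ℝ) * if y i = z then 1 else 0 := by
  rw [requestCount, Finset.card_filter, ← finSigmaFinEquiv.sum_comp, Fintype.sum_sigma]
  simp [blockRequests, periodIndex, hf.eq_iff]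

/-- The variable `1` at `(k, true)`, `-1` at `(k, false)`, `0` elsewhere. -/
def pairSign {C : ℕ} (k : Fin C) (z : Fin C × Bool) : ℝ :=
  (if z = (k, true) then 1 else 0) - if z = (k, false) then 1 else 0

lemma sum_pairSign_pow {C : ℕ} (k : Fin C) (p : ℕ) (hp : p ≠ 0) :
    ∑ z, pairSign k z ^ p = 1 + (-1) ^ p := by
  rw [Fintype.sum_prod_type, Finset.sum_eq_single k]
  · simp [pairSign]
  · intro b _ hb
    simp [pairSign, hb, hp]
  · simp

/-- The best static cache holds the more popular file of every pair. -/
lemma le_bestStaticHits_blockRequests {L C s : ℕ} (r : Fin s → ℕ) {f : Fin C × Bool → Fin L}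
    (hf : Function.Injective f) (y : Fin s → Fin C × Bool) :
    ((∑ i, r i : ℕ) : ℝ) / 2 + 1 / 2 * ∑ k, |∑ i, (r i : ℝ) * pairSign k (y i)| ≤
      bestStaticHits C (blockRequests r f y) := by
  classical
  set X : Fin C × Bool → ℝ := fun z => (requestCount (blockRequests r f y) (f z) : ℝ) with hX
  have htotal : ∑ k, (X (k, true) + X (k, false)) = ((∑ i, r i : ℕ) : ℝ) := by
    have : ∑ z, X z = ∑ k, (X (k, true) + X (k, false)) := by
      rw [Fintype.sum_prod_type]
      simp
    rw [← this]
    simp only [hX, requestCount_blockRequests r hf]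
    rw [Finset.sum_comm]
    simp
  have hdiff : ∀ k, ∑ i, (r i : ℝ) * pairSign k (y i) = X (k, true) - X (k, false) := by
    intro k
    simp only [hX, requestCount_blockRequests r hf, pairSign, mul_sub, Finset.sum_sub_distrib]
  let b : Fin C → Bool := fun k => decide (X (k, false) ≤ X (k, true))
  -- The maximum of two numbers is their mean plus half their distance.
  have hb : ∀ k, (X (k, true) + X (k, false)) / 2 + 1 / 2 * |X (k, true) - X (k, false)| =
      X (k, b k) := by
    intro k
    by_cases h : X (k, false) ≤ X (k, true)
    · rw [abs_of_nonneg (sub_nonneg.2 h)]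
      simp only [b, h, decide_true]
      ring
    · rw [abs_of_neg (sub_neg.2 (not_le.1 h))]
      simp only [b, h, decide_false]
      ring
  have hinj : Function.Injective fun k => f (k, b k) := fun k k' h => by
    have := hf h
    exact congrArg Prod.fst this
  let S : {S : Finset (Fin L) // S.card ≤ C} :=
    ⟨Finset.univ.image fun k => f (k, b k), Finset.card_image_le.trans (by simp)⟩
  refine le_trans (le_of_eq ?_) (le_ciSup (f := fun S : {S : Finset (Fin L) // S.card ≤ C} =>
    ∑ i ∈ S.1, (requestCount (blockRequests r f y) i : ℝ)) (Set.finite_range _).bddAbove S)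
  simp only [S]
  rw [Finset.sum_image fun a _ b _ h => hinj h, ← htotal, Finset.sum_div, Finset.mul_sum,
    ← Finset.sum_add_distrib]
  refine Finset.sum_congr rfl fun k _ => ?_
  rw [hdiff, hb]

/-- The worst case is at least the average over all `(2 * C) ^ s` block words; both sides are
compared after multiplication by this number. -/
theorem le_regret {L C : ℕ} (hC : 1 ≤ C) (hL : 2 * C ≤ L) {s : ℕ} {r : Fin s → ℕ}
    (hs : 1 ≤ s) (hr : ∀ i, 1 ≤ r i) {Ω : Type*} [MeasurableSpace Ω] (μ : Measure Ω)
    [IsProbabilityMeasure μ] (P : RestrictedPolicy L C (∑ i, r i) r Ω) :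
    1 / 2 * (0.15 * √((C : ℝ) * ∑ i, (r i : ℝ) ^ 2) *
      (1 - ((C : ℝ) - 1) * (∑ i, (r i : ℝ) ^ 4) / (2 * (∑ i, (r i : ℝ) ^ 2) ^ 2))) ≤
      P.regret μ := by
  classical
  have hZ : Fintype.card (Fin C × Bool) = 2 * C := by
    simp [mul_comm]
  obtain ⟨⟨f, hf⟩⟩ : Nonempty (Fin C × Bool ↪ Fin L) :=
    Function.Embedding.nonempty_of_card_le (by rw [hZ]; simpa using hL)
  set N : ℝ := (2 * (C : ℝ)) ^ s with hN
  have hcard : (Fintype.card (Fin s → Fin C × Bool) : ℝ) = N := by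
    rw [Fintype.card_fun, hZ, Fintype.card_fin]
    push_cast
    rfl
  have hc : (1 : ℝ) ≤ C := by exact_mod_cast hC
  have hNpos : 0 < N := by positivity
  have hreg : ∑ y : Fin s → Fin C × Bool, P.regretOn μ (blockRequests r f y) ≤
      N * P.regret μ := by
    rw [← hcard, ← nsmul_eq_mul, ← Finset.card_univ, ← Finset.sum_const]
    exact Finset.sum_le_sum fun y _ => le_ciSup (f := fun x => P.regretOn μ x)
      (Set.finite_range _).bddAbove _
  have hint : ∀ (t : Fin (∑ i, r i)) (y : Fin s → Fin C × Bool), Integrable (fun ω =>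
      if blockRequests r f y t ∈ P.cache t (history (blockRequests r f y) t) ω
        then (1 : ℝ) else 0) μ := by
    intro t y
    refine Integrable.of_bound (Measurable.ite (P.measurableSet_mem t _ _) measurable_const
      measurable_const).aestronglyMeasurable 1 (Filter.Eventually.of_forall fun γ => ?_)
    split_ifs <;> simp
  have hhits : ∀ t : Fin (∑ i, r i), ∑ y : Fin s → Fin C × Bool, ∫ ω,
      (if blockRequests r f y t ∈ P.cache t (history (blockRequests r f y) t) ω
        then (1 : ℝ) else 0) ∂μ ≤ N / 2 := by
    intro t
    rw [← integral_finsetSum _ fun y _ => hint t y]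
    have := integral_mono (integrable_finsetSum Finset.univ fun y _ => hint t y)
      (integrable_const (N / 2)) fun ω => by
        have := two_mul_sum_hits_le hC P hZ hf t ω
        simp only
        linarith
    simpa using this
  have hbest := Finset.sum_le_sum fun (y : Fin s → Fin C × Bool) (_ : y ∈ Finset.univ) =>
    le_bestStaticHits_blockRequests r hf y
  rw [Finset.sum_add_distrib, Finset.sum_const, Finset.card_univ, nsmul_eq_mul, hcard,
    ← Finset.mul_sum, Finset.sum_comm] at hbest
  have hhits' := Finset.sum_le_sum fun (t : Fin (∑ i, r i)) (_ : t ∈ Finset.univ) => hhits t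
  rw [Finset.sum_const, Finset.card_univ, Fintype.card_fin, nsmul_eq_mul, Finset.sum_comm]
    at hhits'
  have hQ : 0 < ∑ i, (r i : ℝ) ^ 2 := by
    refine Finset.sum_pos (fun i _ => ?_) ⟨⟨0, hs⟩, Finset.mem_univ _⟩
    have : (0 : ℝ) < r i := by exact_mod_cast hr i
    positivity
  have habs := fun k : Fin C => le_sum_abs_weightedSum (Z := Fin C × Bool) (ξ := pairSign k) hc
    (by rw [hZ]; push_cast; rfl) (by simpa using sum_pairSign_pow k 1 one_ne_zero)
    (by rw [sum_pairSign_pow k 2 two_ne_zero]; norm_num)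
    (by rw [sum_pairSign_pow k 3 (by norm_num)]; norm_num)
    (by rw [sum_pairSign_pow k 4 (by norm_num)]; norm_num) (fun i => (r i : ℝ)) hQ
  have habs' := Finset.sum_le_sum fun (k : Fin C) (_ : k ∈ Finset.univ) => habs k
  rw [Finset.sum_const, Finset.card_univ, Fintype.card_fin, nsmul_eq_mul] at habs'
  -- Each of the `C` pairs contributes a standard deviation `√(Q / C)`, where `Q = ∑ i, r i ^ 2`;
  -- together they give `√(C * Q)`.
  have hsqrt : (C : ℝ) * √((∑ i, (r i : ℝ) ^ 2) / C) = √((C : ℝ) * ∑ i, (r i : ℝ) ^ 2) := by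
    rw [show (C : ℝ) * ∑ i, (r i : ℝ) ^ 2 = (C : ℝ) ^ 2 * ((∑ i, (r i : ℝ) ^ 2) / C) by
      field_simp, Real.sqrt_mul (by positivity), Real.sqrt_sq (by positivity)]
  simp only [RestrictedPolicy.regretOn, Finset.sum_sub_distrib] at hreg
  rw [← hsqrt]
  refine le_of_mul_le_mul_left ?_ hNpos
  linarith

end Caching

end

theorem theorem5 (L C : ℕ) (hC : 1 ≤ C) (hCL : C ≤ L) :
    (2 * C ≤ L →
      ∀ (T s : ℕ) (r : Fin s → ℕ), 1 ≤ s → (∀ i, 1 ≤ r i) → ∑ i, r i = T →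
      ∀ (Ω : Type*) [MeasurableSpace Ω] (μ : MeasureTheory.Measure Ω)
        [MeasureTheory.IsProbabilityMeasure μ] (P : Caching.RestrictedPolicy L C T r Ω),
        P.regret μ ≥
          1 / 2 * (0.15 * √((C : ℝ) * ∑ i, (r i : ℝ) ^ 2) *
              (1 - ((C : ℝ) - 1) * (∑ i, (r i : ℝ) ^ 4) / (2 * (∑ i, (r i : ℝ) ^ 2) ^ 2))
            - 0.6 * (C : ℝ) * ((Finset.univ.sup r : ℕ) : ℝ))) ∧
    (∃ K : ℝ, ∀ (T s : ℕ) (r : Fin s → ℕ), 1 ≤ s → (∀ i, 1 ≤ r i) → ∑ i, r i = T →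
      ∀ α : ℝ, 0 < α →
        (Caching.ftpl L C T r (fun t => α * √(t : ℝ))).regret (Caching.stdNormal L) ≤
          K * (α * √(T : ℝ)) +
            √(2 / Real.pi) *
              ∑ i, (r i : ℝ) ^ 2 / (α * √(1 + ∑ j ∈ Finset.Iio i, (r j : ℝ)))) := by
  refine ⟨fun hL T s r hs hr hT Ω _ μ _ P => ?_,
    2 * Caching.meanAbsPerturbation L, fun T s r hs hr hT α hα => ?_⟩
  · subst hT
    have h := Caching.le_regret hC hL hs hr μ P
    -- The subtracted maximum only weakens the bound already obtained.
    have h0 : (0 : ℝ) ≤ 0.6 * (C : ℝ) * ((Finset.univ.sup r : ℕ) : ℝ) := by positivity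
    linarith
  · have hT0 : 0 < T := by
      have := Caching.periodStart_add_le_sum r ⟨0, hs⟩
      have := hr ⟨0, hs⟩
      omega
    have : Nonempty (Fin T → Fin L) := ⟨fun _ => ⟨0, by omega⟩⟩
    exact ciSup_le fun x => Caching.ftpl_regretOn_le hCL hr hT hT0 hα x
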